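/- Let $k$ be an algebraically closed field and $d,h,n\ge 0$ integers. For a power series $f\in k[[x]]$ algebraic over $k[x]$, its minimal polynomial $P\in k[x,T]$ is a generator (unique up to $k^*$) of the ideal $\{P\in k[x,T] : P(x,f)=0\}$; the degree of $f$ is $\deg_T P$ and its height is $\deg_x P$. Let $\mathcal A(d,h)$ be the set of algebraic power series of degree $\le d$ and height $\le h$. View it as a subset of $\mathbb A_k^{1+N(d,h)}$, where, for $d\ge 1$, $N(d,h)=2dh\max(d-2,0)(d+1)+3dh+d+h-1$ (the set $\mathcal A(0,h)$ is empty), as follows. For $f=\sum_i f_ix^i\in\mathcal A(d,h)$ with minimal polynomial $P$ let $e$ be the order in $x$ of $\frac{\partial P}{\partial T}(x,f)$; it is at most $2dh$. Write $f=f_0+f_1x+\dots+f_ex^e+x^eg$ with $g(0)=0$. The minimal polynomial $Q$ of $g$ satisfies $Q(0,0)=0$, $\frac{\partial Q}{\partial T}(0,0)\neq 0$, $\deg_TQ\le d$ and $\deg_xQ\le h+2dh\max(d-2,0)$; normalize it by $\frac{\partial Q}{\partial T}(0,0)=1$. The coordinates of $f$ are: $f_0$; the first $2dh$ entries of the sequence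 $(f_1,\dots,f_e,1,0,0,\dots)$ (the entry $1$ records the value of $e$); and the coefficients in $Q$ of all monomials $x^iT^j\neq 1,T$ with $i\le h+2dh\max(d-2,0)$ and $j\le d$. **Theorem.** Let $X\subset\mathbb A^n_{k((x))}$ be an algebraic subvariety (closed, defined by an ideal $I\subset k((x))[x_1,\dots,x_n]$) of dimension $m$, that is, $k((x))[x_1,\dots,x_n]/I$ has Krull dimension $m$. Let $X_{d,h}=X(k((x)))\cap\mathcal A(d,h)^n$ be the set of points of $X$ all of whose coordinates lie in $\mathcal A(d,h)$, and let $n_{d,h}(X)$ be the dimension of the Zariski closure of $X_{d,h}$ in $\mathbb A_k^{n(1+N(d,h))}$ (the empty set has dimension $-\infty$). Then $$n_{d,h}(X)\le m(dh+d+h).$$ -/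

import Mathlib

open Polynomial PowerSeries LaurentSeries

noncomputable section

/-- The kernel of the evaluation morphism `k[x][T] → k⟦x⟧`, `P(x, T) ↦ P(x, f)`. Here and below
`k[X][X]` is `k[x][T]`: the outer variable is `T`, the coefficients are polynomials in `x`. -/
def relationIdeal {k : Type*} [Field k] (f : k⟦X⟧) : Ideal k[X][X] :=
  RingHom.ker (Polynomial.aeval f : k[X][X] →ₐ[k[X]] k⟦X⟧)

/-- The kernel of the evaluation morphism at a power series is generated by one polynomial. -/
theorem exists_generator_relationIdeal {k : Type*} [Field k] (f : k⟦X⟧) :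
    ∃ P : k[X][X], relationIdeal f = Ideal.span {P} := by
  have hprime : (relationIdeal f).IsPrime := RingHom.ker_isPrime _
  by_cases hbot : relationIdeal f = ⊥
  · exact ⟨0, by rw [hbot]; simp⟩
  obtain ⟨p, hpI, hp⟩ := hprime.exists_mem_prime_of_ne_bot hbot
  refine ⟨p, le_antisymm ?_ ((Ideal.span_singleton_le_iff_mem _).2 hpI)⟩
  intro q hq
  rw [Ideal.mem_span_singleton]
  have hp0 : Polynomial.aeval f p = 0 := hpI
  have hq0 : Polynomial.aeval f q = 0 := hq
  have hdeg : p.natDegree ≠ 0 := by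
    intro h
    rw [Polynomial.natDegree_eq_zero] at h
    obtain ⟨c, rfl⟩ := h
    rw [Polynomial.aeval_C] at hp0
    have hc : (c : k⟦X⟧) = 0 := by simpa [PowerSeries.algebraMap_apply'] using hp0
    have : c = 0 := Polynomial.coe_eq_zero_iff.1 hc
    exact hp.ne_zero (by simp [this])
  have hprim : p.IsPrimitive := hp.irreducible.isPrimitive hdeg
  have hinj : Function.Injective (algebraMap k[X] k⟦X⟧) := by
    intro a b hab
    apply Polynomial.coe_injective k
    simpa [PowerSeries.algebraMap_apply'] using hab
  have hfaith : FaithfulSMul k[X] (FractionRing k⟦X⟧) := by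
    rw [faithfulSMul_iff_algebraMap_injective, IsScalarTower.algebraMap_eq k[X] k⟦X⟧]
    exact (IsFractionRing.injective k⟦X⟧ (FractionRing k⟦X⟧)).comp hinj
  let _ : Algebra (FractionRing k[X]) (FractionRing k⟦X⟧) := FractionRing.liftAlgebra k[X] _
  have htower : IsScalarTower k[X] (FractionRing k[X]) (FractionRing k⟦X⟧) :=
    FractionRing.isScalarTower_liftAlgebra k[X] _
  have hirr := (hprim.irreducible_iff_irreducible_map_fraction_map (K := FractionRing k[X])).1
    hp.irreducible
  have key : ∀ r : k[X][X], Polynomial.aeval f r = 0 →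
      minpoly (FractionRing k[X]) (algebraMap k⟦X⟧ (FractionRing k⟦X⟧) f) ∣
        r.map (algebraMap k[X] (FractionRing k[X])) := by
    intro r hr
    apply minpoly.dvd
    rw [Polynomial.aeval_map_algebraMap, Polynomial.aeval_algebraMap_apply, hr, map_zero]
  have hass := (hirr.dvd_iff.1 (key p hp0)).resolve_left (minpoly.not_isUnit _ _)
  exact hprim.dvd_of_fraction_map_dvd_fraction_map (K := FractionRing k[X])
    (hass.dvd.trans (key q hq0))

/-- The minimal polynomial over `k[x]` of a power series `f`: a generator of the ideal of all
`P ∈ k[x, T]` with `P(x, f) = 0`. It is unique up to a factor in `k \ {0}`, and it is nonzero if and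
only if `f` is algebraic. -/
def minimalPolynomial {k : Type*} [Field k] (f : k⟦X⟧) : k[X][X] :=
  Classical.choose (exists_generator_relationIdeal f)

/-- The defining property of the minimal polynomial. -/
theorem span_minimalPolynomial {k : Type*} [Field k] (f : k⟦X⟧) :
    relationIdeal f = Ideal.span {minimalPolynomial f} :=
  Classical.choose_spec (exists_generator_relationIdeal f)

/-- The height of `P ∈ k[x][T]`: the maximum of the degrees in `x` of its coefficients. -/
def polynomialHeight {k : Type*} [Field k] (P : k[X][X]) : ℕ :=
  P.support.sup fun j => (P.coeff j).natDegree

/-- `A(d, h)`: the algebraic power series of degree at most `d` and height at most `h`. -/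
def algebraicSeries (k : Type*) [Field k] (d h : ℕ) : Set k⟦X⟧ :=
  {f | IsAlgebraic k[X] f ∧ (minimalPolynomial f).natDegree ≤ d ∧
    polynomialHeight (minimalPolynomial f) ≤ h}

/-- The order `e` in `x` of `(∂P/∂T)(x, f)`, where `P` is the minimal polynomial of `f`. It does not
change when a constant is subtracted from `f`. For algebraic `f` over a perfect field the order is
finite. -/
def derivativeOrder {k : Type*} [Field k] (f : k⟦X⟧) : ℕ :=
  (Polynomial.aeval f (derivative (minimalPolynomial f))).order.toNat

/-- The series `g` with `g(0) = 0` such that `f = f₀ + f₁ x + ⋯ + f_e x ^ e + x ^ e g`. -/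
def seriesTail {k : Type*} [Field k] (e : ℕ) (f : k⟦X⟧) : k⟦X⟧ :=
  PowerSeries.mk fun t => if t = 0 then 0 else PowerSeries.coeff (t + e) f

/-- The number `N(d, h)`; the truncated subtraction `d - 2` matters only for `d ≤ 1`. -/
def embeddingDim (d h : ℕ) : ℕ :=
  2 * d * h * (d - 2) * (d + 1) + 3 * d * h + d + h - 1

/-- The labels of the coordinates in which the elements of `A(d, h)` are recorded: one for the
constant term, `2dh` for the coefficients of `x, …, x ^ e`, where `e ≤ 2dh`, and one for each
monomial `x ^ i T ^ j` other than `1` and `T`, with `i ≤ h + 2dh(d - 2)` and `j ≤ d`. -/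
abbrev CoordIndex (d h : ℕ) : Type :=
  Unit ⊕ Fin (2 * d * h) ⊕
    {p : Fin (h + 2 * d * h * (d - 2) + 1) × Fin (d + 1) // ¬ ((p.1 : ℕ) = 0 ∧ (p.2 : ℕ) ≤ 1)}

/-- There are `1 + N(d, h)` coordinates. -/
theorem card_coordIndex (d h : ℕ) (hd : 1 ≤ d) :
    Fintype.card (CoordIndex d h) = 1 + embeddingDim d h := by
  obtain ⟨b, rfl⟩ : ∃ b, d = b + 1 := ⟨d - 1, by omega⟩
  have hcard : ∀ a : ℕ, Fintype.card
      {p : Fin (a + 1) × Fin (b + 1 + 1) // (p.1 : ℕ) = 0 ∧ (p.2 : ℕ) ≤ 1} = 2 := by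
    intro a
    rw [Fintype.card_subtype]
    have : (Finset.univ.filter fun p : Fin (a + 1) × Fin (b + 1 + 1) =>
        (p.1 : ℕ) = 0 ∧ (p.2 : ℕ) ≤ 1) = {(0, 0), (0, 1)} := by
      ext ⟨i, j⟩
      simp only [Finset.mem_filter, Finset.mem_univ, true_and, Finset.mem_insert,
        Finset.mem_singleton, Prod.mk.injEq, Fin.ext_iff, Fin.val_zero, Fin.val_one]
      omega
    rw [this, Finset.card_pair (by simp)]
  rw [Fintype.card_sum, Fintype.card_sum, Fintype.card_subtype_compl, hcard]
  simp only [Fintype.card_unit, Fintype.card_fin, Fintype.card_prod, embeddingDim]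
  generalize b + 1 - 2 = c
  have h1 : (h + 2 * (b + 1) * h * c + 1) * (b + 1 + 1) =
      2 * (b + 1) * h * c * (b + 1 + 1) + (b + 1) * h + h + b + 2 := by ring
  have h2 : 3 * (b + 1) * h = 2 * (b + 1) * h + (b + 1) * h := by ring
  rw [h1, h2]
  omega

/-- The point of affine space attached to `f ∈ A(d, h)`. Let `P` be the minimal polynomial of `f`,
`e` the order of `(∂P/∂T)(x, f)`, and `f = f₀ + f₁ x + ⋯ + f_e x ^ e + x ^ e g` with `g(0) = 0`. The
coordinates are the constant term `f₀`; then `f₁, …, f_e` followed by `1, 0, …, 0`, where the entry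
`1` marks the length `e`; then the coefficients of the minimal polynomial `Q` of `g`, normalized so
that the coefficient of `T` is `1` (the coefficient of `1` is `0`). -/
def seriesCoord {k : Type*} [Field k] (d h : ℕ) (f : k⟦X⟧) : CoordIndex d h → k
  | Sum.inl _ => PowerSeries.constantCoeff f
  | Sum.inr (Sum.inl t) =>
      if (t : ℕ) < derivativeOrder f then PowerSeries.coeff (t + 1) f
      else if (t : ℕ) = derivativeOrder f then 1 else 0
  | Sum.inr (Sum.inr p) =>
      ((minimalPolynomial (seriesTail (derivativeOrder f) f)).coeff p.1.2).coeff p.1.1 /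
        ((minimalPolynomial (seriesTail (derivativeOrder f) f)).coeff 1).coeff 0

/-- The Zariski closure of a set of points of affine space. -/
def zariskiClosure {k σ : Type*} [Field k] (S : Set (σ → k)) : Set (σ → k) :=
  MvPolynomial.zeroLocus k (MvPolynomial.vanishingIdeal k S)

/-- The dimension of an algebraic set: the Krull dimension of its coordinate ring; it is `⊥` for the
empty set. -/
def algebraicSetDim {k σ : Type*} [Field k] (V : Set (σ → k)) : WithBot ℕ∞ :=
  ringKrullDim (MvPolynomial σ k ⧸ MvPolynomial.vanishingIdeal k V)

/-- The points of `E ∩ A(d, h) ^ n`, for a set `E` of points with coordinates in `k((x))`. -/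
def boundedPoints {k : Type*} [Field k] {n : ℕ} (d h : ℕ) (E : Set (Fin n → k⸨X⸩)) :
    Set (Fin n → k⟦X⟧) :=
  {f | (∀ i, f i ∈ algebraicSeries k d h) ∧ (fun i => algebraMap k⟦X⟧ k⸨X⸩ (f i)) ∈ E}

/-- `n_{d,h}(E)`: the dimension of the Zariski closure of `E ∩ A(d, h) ^ n` in affine space. -/
def boundedDim {k : Type*} [Field k] {n : ℕ} (d h : ℕ) (E : Set (Fin n → k⸨X⸩)) : WithBot ℕ∞ :=
  algebraicSetDim (zariskiClosure
    ((fun (f : Fin n → k⟦X⟧) (c : Fin n × CoordIndex d h) => seriesCoord d h (f c.1) c.2) ''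
      boundedPoints d h E))

end

/-!
The proof passes to a generic point of the set of bounded points and counts transcendence degrees.

Let `S` be the set of points of `X` with coordinates in `A(d, h)`. Noether normalization, applied to
the ring of polynomial functions on `S`, gives algebraically independent functions whose number is
the dimension to be bounded, and an ultrafilter on `S` can be chosen along which they remain
algebraically independent. So it is enough (`algebraicSetDim_zariskiClosure_range_le`) to bound, in
every ultrapower `K` of `k` over `S`, the transcendence degree over `k` of a field that contains the
limits of the coordinates. A family of series has a limit in `K⟦X⟧`, taken coefficient by
coefficient, and the limits `f₁, …, fₙ` of the coordinates of the points still satisfy the equations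
of `X`. Hence at most `m` of the `fᵢ` are algebraically independent over `k⟦X⟧`
(`card_le_of_algebraicIndepOn_limitSeries`); let `fᵢ`, for `i ∈ B`, be a maximal independent
subfamily.

Each `fᵢ` is a root of the limit of the minimal polynomials, which has `(d + 1)(h + 1)`
coefficients, one of which can be normalized to `1`. Let `L` be the relative algebraic closure in
`K` of the field generated by these normalized coefficients for `i ∈ B`. Its transcendence degree
is at most `m (dh + d + h)`, and it contains all limits of coordinates, for three reasons.

* A series over `K` that is algebraic over `L⟦X⟧` has its coefficients in `L`
  (`coeff_mem_range_of_isAlgebraic`). This applies first to `fᵢ` with `i ∈ B`, and then to the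
  remaining `fᵢ`, which are algebraic over the subring generated by those.
* The order of `(∂P/∂T)(x, f)`, if finite, is bounded because of a resultant (`order_aeval_le`), so
  it is constant on a member of the ultrafilter. There, the number of the coefficients of `f` that
  are recorded is constant, and the tail `g` also has its limit coefficients in `L`.
* The same bound shows that a relation between `x` and the limit of the tails comes from relations
  between `x` and the tails themselves. Therefore the relations of the bidegree of the minimal
  polynomials form a line, which is defined by linear equations with coefficients in `L`, and the
  ratios of the coefficients of the minimal polynomials lie in `L` (`div_familyCoeff_mem`).
-/

noncomputable section

/-! ### Krull dimension and algebraic independence -/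

/-- Going up, along a chain of primes that ends in `P`. -/
theorem exists_comap_eq_le_height {R S : Type*} [CommRing R] [CommRing S] [Algebra R S]
    [Algebra.IsIntegral R S] (hinj : Function.Injective (algebraMap R S)) (n : ℕ)
    (P : PrimeSpectrum R) (hn : (n : ℕ∞) ≤ Order.height P) :
    ∃ Q : PrimeSpectrum S, PrimeSpectrum.comap (algebraMap R S) Q = P ∧
      (n : ℕ∞) ≤ Order.height Q := by
  induction n generalizing P with
  | zero =>
    have hker : RingHom.ker (algebraMap R S) ≤ P.asIdeal := by
      rw [(RingHom.injective_iff_ker_eq_bot _).1 hinj]; exact bot_le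
    obtain ⟨Q, -, hQ, hQP⟩ := Ideal.exists_ideal_over_prime_of_isIntegral P.asIdeal (⊥ : Ideal S)
      hker
    exact ⟨⟨Q, hQ⟩, PrimeSpectrum.ext hQP, by simp⟩
  | succ n ih =>
    obtain ⟨l, hl, hlen⟩ := Order.exists_series_of_le_height P hn
    have hlt : l.eraseLast.last < P := hl ▸ l.eraseLast_last_rel_last (by omega)
    have hP' : (n : ℕ∞) ≤ Order.height l.eraseLast.last := by
      refine le_trans ?_ (Order.length_le_height_last (p := l.eraseLast))
      simp [hlen]
    obtain ⟨Q', hQ', hnQ'⟩ := ih _ hP'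
    have hle : Q'.asIdeal.comap (algebraMap R S) ≤ P.asIdeal :=
      (congrArg PrimeSpectrum.asIdeal hQ').trans_le hlt.le
    obtain ⟨Q, hge, hQ, hQP⟩ :=
      Ideal.exists_ideal_over_prime_of_isIntegral P.asIdeal Q'.asIdeal hle
    refine ⟨⟨Q, hQ⟩, PrimeSpectrum.ext hQP, ?_⟩
    have hne : Q' ≠ ⟨Q, hQ⟩ := by
      rintro rfl
      exact hlt.ne (hQ'.symm.trans (PrimeSpectrum.ext hQP))
    have hQlt : Q' < ⟨Q, hQ⟩ := lt_of_le_of_ne hge hne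
    push_cast
    exact (add_le_add_left hnQ' 1).trans (Order.height_add_one_le hQlt)

theorem ringKrullDim_le_of_isIntegral_of_injective {R S : Type*} [CommRing R] [CommRing S]
    [Algebra R S] [Algebra.IsIntegral R S] (hinj : Function.Injective (algebraMap R S)) :
    ringKrullDim R ≤ ringKrullDim S := by
  refine iSup_le fun l => ?_
  obtain ⟨Q, -, hQ⟩ := exists_comap_eq_le_height hinj l.length l.last
    Order.length_le_height_last
  exact (WithBot.coe_le_coe.2 hQ).trans (Order.height_le_krullDim Q)

theorem ringKrullDim_le_of_isIntegral {R S : Type*} [CommRing R] [CommRing S]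
    [Algebra R S] [Algebra.IsIntegral R S] : ringKrullDim S ≤ ringKrullDim R :=
  Order.krullDim_le_of_strictMono (PrimeSpectrum.comap (algebraMap R S)) fun I J hIJ =>
    Ideal.IsIntegral.comap_lt_comap (I := I.asIdeal) (J := J.asIdeal) hIJ

/-- Noether normalization gives algebraically independent elements whose number is the Krull
dimension. -/
theorem exists_algebraicIndependent_ringKrullDim_eq (F A : Type*) [Field F] [CommRing A]
    [Nontrivial A] [Algebra F A] [Algebra.FiniteType F A] :
    ∃ (s : ℕ) (y : Fin s → A), AlgebraicIndependent F y ∧ ringKrullDim A = s := by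
  obtain ⟨s, g, hinj, hint⟩ := exists_integral_inj_algHom_of_fg F A
  refine ⟨s, fun i => g (MvPolynomial.X i), ?_, ?_⟩
  · rw [algebraicIndependent_iff_injective_aeval]
    convert hinj
    ext; simp
  · algebraize [g.toRingHom]
    have : Algebra.IsIntegral (MvPolynomial (Fin s) F) A := ⟨hint⟩
    refine (le_antisymm (ringKrullDim_le_of_isIntegral (R := MvPolynomial (Fin s) F))
      (ringKrullDim_le_of_isIntegral_of_injective hinj)).trans ?_
    rw [MvPolynomial.ringKrullDim_of_isNoetherianRing]
    simp

theorem card_le_ringKrullDim_of_isDomain {F A ι : Type*} [Field F] [CommRing A] [IsDomain A]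
    [Algebra F A] [Algebra.FiniteType F A] [Fintype ι] {x : ι → A}
    (hx : AlgebraicIndependent F x) : (Fintype.card ι : WithBot ℕ∞) ≤ ringKrullDim A := by
  obtain ⟨s, g, hinj, hint⟩ := exists_integral_inj_algHom_of_fg F A
  have hdim : (s : WithBot ℕ∞) ≤ ringKrullDim A := by
    algebraize [g.toRingHom]
    have : Algebra.IsIntegral (MvPolynomial (Fin s) F) A := ⟨hint⟩
    refine le_trans ?_
      (ringKrullDim_le_of_isIntegral_of_injective (R := MvPolynomial (Fin s) F) hinj)
    rw [MvPolynomial.ringKrullDim_of_isNoetherianRing]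
    simp
  have htr : Fintype.card ι ≤ s := by
    algebraize [g.toRingHom]
    have : Algebra.IsIntegral (MvPolynomial (Fin s) F) A := ⟨hint⟩
    have : FaithfulSMul (MvPolynomial (Fin s) F) A :=
      (faithfulSMul_iff_algebraMap_injective _ _).2 hinj
    have : IsScalarTower F (MvPolynomial (Fin s) F) A :=
      IsScalarTower.of_algebraMap_eq fun r => (g.commutes r).symm
    have h1 := ((IsTranscendenceBasis.mvPolynomial (Fin s) F).algebraMap_comp
      (A := A)).lift_cardinalMk_eq_trdeg
    have h2 := hx.lift_cardinalMk_le_trdeg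
    rw [Cardinal.mk_fintype] at h1 h2
    simp only [Fintype.card_fin, Cardinal.lift_natCast, Cardinal.lift_uzero] at h1 h2
    rw [← h1, Cardinal.lift_natCast] at h2
    exact_mod_cast h2
  exact le_trans (by exact_mod_cast htr) hdim

/-- The number of algebraically independent elements of a finitely generated algebra is at most
its Krull dimension; the algebra need not be a domain. -/
theorem card_le_ringKrullDim {F A ι : Type*} [Field F] [CommRing A]
    [Algebra F A] [Algebra.FiniteType F A] [Fintype ι] {x : ι → A}
    (hx : AlgebraicIndependent F x) : (Fintype.card ι : WithBot ℕ∞) ≤ ringKrullDim A := by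
  -- A minimal prime over `0` of the polynomial ring generated by `x` is the trace of a prime.
  obtain ⟨p, hp, hcomap⟩ := Ideal.exists_comap_eq_of_mem_minimalPrimes_of_injective
    (f := (MvPolynomial.aeval x : MvPolynomial ι F →ₐ[F] A).toRingHom) hx ⊥ (by
      rw [IsDomain.minimalPrimes_eq_singleton_bot]; rfl)
  have hx' : AlgebraicIndependent F (fun i => Ideal.Quotient.mkₐ F p (x i)) := by
    rw [algebraicIndependent_iff]
    intro q hq
    have h : Ideal.Quotient.mkₐ F p (MvPolynomial.aeval x q) = 0 := by
      rw [← hq, ← AlgHom.comp_apply, MvPolynomial.comp_aeval]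
    rw [Ideal.Quotient.mkₐ_eq_mk, Ideal.Quotient.eq_zero_iff_mem] at h
    have : q ∈ p.comap (MvPolynomial.aeval x : MvPolynomial ι F →ₐ[F] A).toRingHom := h
    rwa [hcomap] at this
  exact (card_le_ringKrullDim_of_isDomain hx').trans (ringKrullDim_quotient_le p)

/-! ### Power series that are algebraic over a field of constants -/

section ConstantField

variable {L K : Type*} [Field L] [Field K] [Algebra L K]

/-- An algebraic relation over `L⟦X⟧` can be divided by a power of `X` until it does not vanish
modulo `X`. -/
theorem exists_aeval_eq_zero_map_constantCoeff_ne_zero {f : K⟦X⟧} (hf : IsAlgebraic L⟦X⟧ f) :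
    ∃ P : L⟦X⟧[X], aeval f P = 0 ∧ P.map (PowerSeries.constantCoeff (R := L)) ≠ 0 := by
  obtain ⟨P, hP0, hP⟩ := hf
  induction hn : P.leadingCoeff.order.toNat using Nat.strong_induction_on generalizing P with
  | _ n ih =>
    by_cases hmap : P.map (PowerSeries.constantCoeff (R := L)) = 0
    · have hdvd : Polynomial.C (PowerSeries.X : L⟦X⟧) ∣ P := by
        rw [Polynomial.C_dvd_iff_dvd_coeff]
        intro i
        rw [PowerSeries.X_dvd_iff, ← Polynomial.coeff_map, hmap, Polynomial.coeff_zero]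
      obtain ⟨P', rfl⟩ := hdvd
      have hP'0 : P' ≠ 0 := right_ne_zero_of_mul hP0
      have hX : algebraMap L⟦X⟧ K⟦X⟧ PowerSeries.X ≠ 0 := by
        rw [PowerSeries.algebraMap_apply'', PowerSeries.map_X]
        exact PowerSeries.X_ne_zero
      rw [map_mul, Polynomial.aeval_C] at hP
      refine ih _ ?_ P' hP'0 ((mul_eq_zero.1 hP).resolve_left hX) rfl
      have hlc : P'.leadingCoeff ≠ 0 := Polynomial.leadingCoeff_ne_zero.2 hP'0
      rw [← hn, Polynomial.leadingCoeff_mul, Polynomial.leadingCoeff_C, PowerSeries.order_mul,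
        PowerSeries.order_X, ENat.toNat_add (by simp) (by simpa using hlc)]
      simp
    · exact ⟨P, hP, hmap⟩

theorem isAlgebraic_constantCoeff {f : K⟦X⟧} (hf : IsAlgebraic L⟦X⟧ f) :
    IsAlgebraic L (PowerSeries.constantCoeff f) := by
  obtain ⟨P, hP, hP0⟩ := exists_aeval_eq_zero_map_constantCoeff_ne_zero hf
  refine ⟨_, hP0, ?_⟩
  rw [aeval_def, Polynomial.eval₂_map, ← map_zero (PowerSeries.constantCoeff (R := K)), ← hP,
    aeval_def, Polynomial.hom_eval₂]
  congr 1

/-- A power series that is algebraic over `L⟦X⟧`, where `L` is algebraically closed in `K`, has its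
coefficients in `L`: its constant term `f₀` is algebraic over `L`, and `(f - f₀) / X` is algebraic
over `L⟦X⟧` again. -/
theorem coeff_mem_range_of_isAlgebraic
    (hL : ∀ a : K, IsAlgebraic L a → a ∈ (algebraMap L K).range) (t : ℕ) {f : K⟦X⟧}
    (hf : IsAlgebraic L⟦X⟧ f) : PowerSeries.coeff t f ∈ (algebraMap L K).range := by
  induction t generalizing f with
  | zero =>
    rw [PowerSeries.coeff_zero_eq_constantCoeff_apply]
    exact hL _ (isAlgebraic_constantCoeff hf)
  | succ t ih =>
    obtain ⟨a, ha⟩ := hL _ (isAlgebraic_constantCoeff hf)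
    have hC : IsAlgebraic L⟦X⟧ (PowerSeries.C (PowerSeries.constantCoeff f)) := by
      rw [← ha, ← PowerSeries.map_C, ← PowerSeries.algebraMap_apply'']
      exact isAlgebraic_algebraMap _
    have h := hf.sub hC
    rw [PowerSeries.sub_const_eq_shift_mul_X] at h
    have hX : IsAlgebraic L⟦X⟧ (PowerSeries.X : K⟦X⟧) := by
      rw [← PowerSeries.map_X (algebraMap L K), ← PowerSeries.algebraMap_apply'']
      exact isAlgebraic_algebraMap _
    rw [mul_comm] at h
    have h2 := IsAlgebraic.of_mul (mem_nonZeroDivisors_of_ne_zero PowerSeries.X_ne_zero) hX h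
    simpa using ih h2

end ConstantField

/-! ### Bidegrees of polynomials in two variables -/

section Bidegree

variable {k : Type*} [Field k]

theorem coeff_coeff_swap (P : k[X][X]) (i j : ℕ) :
    ((Bivariate.swap P).coeff i).coeff j = (P.coeff j).coeff i := by
  induction P using Polynomial.induction_on' with
  | add p q hp hq => simp only [map_add, Polynomial.coeff_add, hp, hq]
  | monomial n a =>
    induction a using Polynomial.induction_on' with
    | add p q hp hq => simp only [map_add, Polynomial.coeff_add, hp, hq]
    | monomial m r =>
      rw [Bivariate.swap_monomial_monomial]
      simp only [Polynomial.coeff_monomial]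
      split_ifs <;> simp [Polynomial.coeff_monomial, *]

/-- The degree in `x` of a polynomial in `x` and `T` is the degree in the outer variable after the
variables are exchanged. -/
theorem natDegree_swap_le_iff (P : k[X][X]) (h : ℕ) :
    (Bivariate.swap P).natDegree ≤ h ↔ ∀ j, (P.coeff j).natDegree ≤ h := by
  simp_rw [Polynomial.natDegree_le_iff_coeff_eq_zero]
  constructor
  · intro H j N hN
    rw [← coeff_coeff_swap, H N hN, Polynomial.coeff_zero]
  · intro H N hN
    ext j
    rw [coeff_coeff_swap, H j N hN, Polynomial.coeff_zero]

theorem polynomialHeight_eq (P : k[X][X]) :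
    polynomialHeight P = (Bivariate.swap P).natDegree := by
  apply le_antisymm
  · exact Finset.sup_le fun j _ => (natDegree_swap_le_iff P _).1 le_rfl j
  · rw [natDegree_swap_le_iff]
    intro j
    by_cases hj : j ∈ P.support
    · exact Finset.le_sup (f := fun j => (P.coeff j).natDegree) hj
    · simp [Polynomial.notMem_support_iff.1 hj]

theorem natDegree_coeff_le_polynomialHeight (P : k[X][X]) (j : ℕ) :
    (P.coeff j).natDegree ≤ polynomialHeight P :=
  (natDegree_swap_le_iff P _).1 (polynomialHeight_eq P).ge j

theorem polynomialHeight_le_iff {P : k[X][X]} {h : ℕ} :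
    polynomialHeight P ≤ h ↔ ∀ j, (P.coeff j).natDegree ≤ h := by
  rw [polynomialHeight_eq, natDegree_swap_le_iff]

theorem polynomialHeight_le_of_dvd {P R : k[X][X]} (hdvd : P ∣ R) (hR : R ≠ 0) :
    polynomialHeight P ≤ polynomialHeight R := by
  obtain ⟨Q, rfl⟩ := hdvd
  rw [polynomialHeight_eq, polynomialHeight_eq, map_mul]
  have hinj := (Bivariate.swap (R := k)).injective
  have hP : Bivariate.swap P ≠ 0 :=
    (map_ne_zero_iff _ hinj).2 (left_ne_zero_of_mul hR)
  have hQ : Bivariate.swap Q ≠ 0 :=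
    (map_ne_zero_iff _ hinj).2 (right_ne_zero_of_mul hR)
  rw [Polynomial.natDegree_mul hP hQ]
  exact Nat.le_add_right _ _

theorem polynomialHeight_derivative_le (P : k[X][X]) :
    polynomialHeight (derivative P) ≤ polynomialHeight P := by
  rw [polynomialHeight_le_iff]
  intro j
  rw [Polynomial.coeff_derivative]
  rw [show ((j : k[X]) + 1) = Polynomial.C ((j : k) + 1) by simp]
  exact (Polynomial.natDegree_mul_C_le (P.coeff (j + 1)) ((j : k) + 1)).trans
    (natDegree_coeff_le_polynomialHeight P (j + 1))

/-- The height after the substitution `T ↦ a(x) + x ^ e T` with `deg a ≤ e`. -/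
theorem polynomialHeight_comp_le (P : k[X][X]) (a : k[X]) (e : ℕ) (ha : a.natDegree ≤ e) :
    polynomialHeight (P.comp (Polynomial.C a + Polynomial.C (Polynomial.X ^ e) * Polynomial.X)) ≤
      polynomialHeight P + P.natDegree * e := by
  have hq : (Bivariate.swap
      (Polynomial.C a + Polynomial.C (Polynomial.X ^ e) * Polynomial.X : k[X][X])).natDegree
        ≤ e := by
    rw [natDegree_swap_le_iff]
    intro j
    refine (Polynomial.natDegree_le_iff_coeff_eq_zero.2 fun N hN => ?_)
    simp only [Polynomial.coeff_add, Polynomial.coeff_C, Polynomial.coeff_C_mul,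
      Polynomial.coeff_X]
    have : a.coeff N = 0 := Polynomial.coeff_eq_zero_of_natDegree_lt (by omega)
    split_ifs <;> simp [this, Polynomial.coeff_X_pow] <;> omega
  rw [polynomialHeight_eq, Polynomial.comp, Polynomial.eval₂_eq_sum_range, map_sum]
  refine Polynomial.natDegree_sum_le_of_forall_le _ _ fun j hj => ?_
  rw [map_mul, map_pow]
  refine Polynomial.natDegree_mul_le.trans (add_le_add ?_ ?_)
  · rw [natDegree_swap_le_iff]
    intro i
    rw [Polynomial.coeff_C]
    split_ifs
    · exact natDegree_coeff_le_polynomialHeight _ _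
    · simp
  · refine Polynomial.natDegree_pow_le.trans (Nat.mul_le_mul ?_ hq)
    rw [Finset.mem_range] at hj
    omega

/-- The degree of a resultant of two polynomials in `x` and `T` with respect to `T`. -/
theorem natDegree_resultant_le (P R : k[X][X]) (m n H : ℕ) (hP : polynomialHeight P ≤ H)
    (hR : polynomialHeight R ≤ H) : (Polynomial.resultant P R m n).natDegree ≤ (m + n) * H := by
  rw [Polynomial.resultant, Matrix.det_apply]
  refine Polynomial.natDegree_sum_le_of_forall_le _ _ fun σ _ => ?_
  refine (Polynomial.natDegree_smul_le _ _).trans ((Polynomial.natDegree_prod_le _ _).trans ?_)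
  refine (Finset.sum_le_card_nsmul _ _ H fun i _ => ?_).trans (by simp)
  rw [Polynomial.sylvester, Matrix.of_apply]
  refine Fin.addCases (fun j => ?_) (fun j => ?_) i
  · rw [Fin.addCases_left]
    split_ifs
    · exact (natDegree_coeff_le_polynomialHeight _ _).trans hR
    · simp
  · rw [Fin.addCases_right]
    split_ifs
    · exact (natDegree_coeff_le_polynomialHeight _ _).trans hP
    · simp

end Bidegree

/-! ### Orders of polynomial expressions in an algebraic series -/

section MinimalPolynomial

variable {k : Type*} [Field k]

theorem aeval_eq_zero_iff_minimalPolynomial_dvd {f : k⟦X⟧} {R : k[X][X]} :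
    aeval f R = 0 ↔ minimalPolynomial f ∣ R := by
  rw [← Ideal.mem_span_singleton, ← span_minimalPolynomial]
  exact Iff.rfl

theorem aeval_minimalPolynomial (f : k⟦X⟧) : aeval f (minimalPolynomial f) = 0 :=
  aeval_eq_zero_iff_minimalPolynomial_dvd.2 dvd_rfl

theorem minimalPolynomial_ne_zero {f : k⟦X⟧} (hf : IsAlgebraic k[X] f) :
    minimalPolynomial f ≠ 0 := by
  obtain ⟨R, hR0, hR⟩ := hf
  intro h
  rw [aeval_eq_zero_iff_minimalPolynomial_dvd, h, zero_dvd_iff] at hR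
  exact hR0 hR

theorem prime_minimalPolynomial {f : k⟦X⟧} (hf : IsAlgebraic k[X] f) :
    Prime (minimalPolynomial f) := by
  have h : (relationIdeal f).IsPrime := RingHom.ker_isPrime _
  rw [span_minimalPolynomial] at h
  exact (Ideal.span_singleton_prime (minimalPolynomial_ne_zero hf)).1 h

theorem algebraMap_polynomial_powerSeries_injective :
    Function.Injective (algebraMap k[X] k⟦X⟧) := by
  intro a b hab
  apply Polynomial.coe_injective k
  simpa [PowerSeries.algebraMap_apply'] using hab

theorem natDegree_minimalPolynomial_ne_zero {f : k⟦X⟧} (hf : IsAlgebraic k[X] f) :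
    (minimalPolynomial f).natDegree ≠ 0 := by
  intro h
  obtain ⟨c, hc⟩ := Polynomial.natDegree_eq_zero.1 h
  have h0 := aeval_minimalPolynomial f
  rw [← hc, Polynomial.aeval_C] at h0
  apply minimalPolynomial_ne_zero hf
  rw [← hc, algebraMap_polynomial_powerSeries_injective (h0.trans (map_zero _).symm), map_zero]

/-- A polynomial expression in an algebraic series is either zero or of bounded order: a nonzero
resultant with the minimal polynomial is a multiple of its value, and has bounded degree. -/
theorem order_aeval_le {f : k⟦X⟧} (hf : IsAlgebraic k[X] f) {R : k[X][X]}
    (hR : aeval f R ≠ 0) :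
    (aeval f R).order.toNat ≤ ((minimalPolynomial f).natDegree + R.natDegree) *
      max (polynomialHeight (minimalPolynomial f)) (polynomialHeight R) := by
  set P := minimalPolynomial f with hPdef
  have hdeg := natDegree_minimalPolynomial_ne_zero hf
  have hirr : Irreducible P := (prime_minimalPolynomial hf).irreducible
  have hprim : P.IsPrimitive := hirr.isPrimitive hdeg
  have hinj := IsFractionRing.injective k[X] (FractionRing k[X])
  set φ := algebraMap k[X] (FractionRing k[X])
  have hirr' : Irreducible (P.map φ) :=
    (hprim.irreducible_iff_irreducible_map_fraction_map (K := FractionRing k[X])).1 hirr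
  have hcop : IsCoprime (P.map φ) (R.map φ) := by
    rw [hirr'.coprime_iff_not_dvd]
    intro h
    exact hR (aeval_eq_zero_iff_minimalPolynomial_dvd.2
      (hprim.dvd_of_fraction_map_dvd_fraction_map (K := FractionRing k[X]) h))
  have hres : Polynomial.resultant P R ≠ 0 := by
    have h := Polynomial.resultant_ne_zero _ _ hcop
    rw [Polynomial.natDegree_map_eq_of_injective hinj,
      Polynomial.natDegree_map_eq_of_injective hinj, Polynomial.resultant_map_map] at h
    exact fun h0 => h (by rw [h0, map_zero])
  obtain ⟨u, v, -, -, huv⟩ := Polynomial.exists_mul_add_mul_eq_C_resultant P R le_rfl le_rfl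
    (Or.inl hdeg)
  have hval := congrArg (aeval f) huv
  rw [map_add, map_mul, map_mul, aeval_minimalPolynomial, zero_mul, zero_add,
    Polynomial.aeval_C] at hval
  have hle := natDegree_resultant_le P R P.natDegree R.natDegree _
    (le_max_left (polynomialHeight P) (polynomialHeight R)) (le_max_right _ _)
  refine le_trans ?_ hle
  set r := Polynomial.resultant P R
  have hord : (algebraMap k[X] k⟦X⟧ r).order ≤ r.natDegree := by
    apply PowerSeries.order_le
    have : algebraMap k[X] k⟦X⟧ r = (r : k⟦X⟧) := by
      simp [PowerSeries.algebraMap_apply']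
    rw [this, Polynomial.coeff_coe, Polynomial.coeff_natDegree]
    exact Polynomial.leadingCoeff_ne_zero.2 hres
  rw [← hval, PowerSeries.order_mul] at hord
  exact ENat.toNat_le_of_le_natCast (le_self_add.trans hord)

theorem aeval_eq_zero_of_coeff_eq_zero {f : k⟦X⟧} (hf : IsAlgebraic k[X] f) {R : k[X][X]}
    (hR : ∀ t ≤ ((minimalPolynomial f).natDegree + R.natDegree) *
      max (polynomialHeight (minimalPolynomial f)) (polynomialHeight R),
      PowerSeries.coeff t (aeval f R) = 0) : aeval f R = 0 := by
  by_contra h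
  exact PowerSeries.coeff_order h (hR _ (order_aeval_le hf h))

theorem derivativeOrder_le {d h : ℕ} {f : k⟦X⟧} (hf : f ∈ algebraicSeries k d h) :
    derivativeOrder f ≤ 2 * d * h := by
  obtain ⟨halg, hd, hh⟩ := hf
  rw [derivativeOrder]
  by_cases h0 : aeval f (derivative (minimalPolynomial f)) = 0
  · simp [h0]
  · refine (order_aeval_le halg h0).trans (Nat.mul_le_mul ?_ ?_)
    · have := Polynomial.natDegree_derivative_le (minimalPolynomial f)
      omega
    · exact max_le hh ((polynomialHeight_derivative_le _).trans hh)

/-- A relation whose bidegree is at most that of the minimal polynomial is proportional to it. -/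
theorem eq_C_C_mul_minimalPolynomial {f : k⟦X⟧} (hf : IsAlgebraic k[X] f) {R : k[X][X]}
    (hR : aeval f R = 0) (hd : R.natDegree ≤ (minimalPolynomial f).natDegree)
    (hh : polynomialHeight R ≤ polynomialHeight (minimalPolynomial f)) :
    ∃ c : k, R = Polynomial.C (Polynomial.C c) * minimalPolynomial f := by
  obtain ⟨Q, rfl⟩ := aeval_eq_zero_iff_minimalPolynomial_dvd.1 hR
  have hP := minimalPolynomial_ne_zero hf
  by_cases hQ : Q = 0
  · exact ⟨0, by simp [hQ]⟩
  rw [Polynomial.natDegree_mul hP hQ] at hd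
  obtain ⟨q, rfl⟩ := Polynomial.natDegree_eq_zero.1 (show Q.natDegree = 0 by omega)
  have hinj := (Bivariate.swap (R := k)).injective
  rw [polynomialHeight_eq, polynomialHeight_eq, map_mul, Polynomial.natDegree_mul
    ((map_ne_zero_iff _ hinj).2 hP) ((map_ne_zero_iff _ hinj).2 hQ)] at hh
  have hq := (natDegree_swap_le_iff (Polynomial.C q) 0).1 (by omega) 0
  rw [Polynomial.coeff_C_zero] at hq
  obtain ⟨c, rfl⟩ := Polynomial.natDegree_eq_zero.1 (Nat.le_zero.1 hq)
  exact ⟨c, mul_comm _ _⟩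

theorem trunc_add_X_pow_mul_seriesTail (e : ℕ) (f : k⟦X⟧) :
    ((PowerSeries.trunc (e + 1) f : k[X]) : k⟦X⟧) + PowerSeries.X ^ e * seriesTail e f = f := by
  ext t
  rw [map_add, Polynomial.coeff_coe, PowerSeries.coeff_trunc, PowerSeries.coeff_X_pow_mul',
    seriesTail, PowerSeries.coeff_mk]
  rcases lt_trichotomy t e with h | rfl | h
  · rw [if_pos (by omega), if_neg (by omega), add_zero]
  · simp
  · rw [if_neg (by omega), if_pos h.le, if_neg (by omega), zero_add, Nat.sub_add_cancel h.le]

/-- The substitution `T ↦ f₀ + ⋯ + f_e x ^ e + x ^ e T` turns the relation for `f` into a relation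
for `g`, which bounds the degree and the height of `g`. -/
theorem seriesTail_mem_algebraicSeries {d h : ℕ} {f : k⟦X⟧} (hf : f ∈ algebraicSeries k d h)
    (e : ℕ) : seriesTail e f ∈ algebraicSeries k d (h + d * e) := by
  obtain ⟨halg, hd, hh⟩ := hf
  set a := PowerSeries.trunc (e + 1) f
  set q : k[X][X] := Polynomial.C a + Polynomial.C (Polynomial.X ^ e) * Polynomial.X with hq
  have ha : a.natDegree ≤ e := Nat.lt_succ_iff.1 (PowerSeries.natDegree_trunc_lt f e)
  have hqdeg : q.natDegree = 1 := by
    rw [hq, add_comm]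
    exact Polynomial.natDegree_linear (pow_ne_zero _ Polynomial.X_ne_zero)
  set R := (minimalPolynomial f).comp q with hRdef
  have hRdeg : R.natDegree = (minimalPolynomial f).natDegree := by
    rw [hRdef, Polynomial.natDegree_comp, hqdeg, mul_one]
  have hR0 : R ≠ 0 := by
    intro h0
    rw [h0, Polynomial.natDegree_zero] at hRdeg
    exact natDegree_minimalPolynomial_ne_zero halg hRdeg.symm
  have hqval : aeval (seriesTail e f) q = f := by
    conv_rhs => rw [← trunc_add_X_pow_mul_seriesTail e f]
    simp [hq, PowerSeries.algebraMap_apply', a]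
  have hR : aeval (seriesTail e f) R = 0 := by
    rw [hRdef, Polynomial.aeval_comp, hqval, aeval_minimalPolynomial]
  have hdvd := aeval_eq_zero_iff_minimalPolynomial_dvd.1 hR
  refine ⟨⟨R, hR0, hR⟩, ?_, ?_⟩
  · exact (Polynomial.natDegree_le_of_dvd hdvd hR0).trans (hRdeg.trans_le hd)
  · refine (polynomialHeight_le_of_dvd hdvd hR0).trans
      ((polynomialHeight_comp_le _ _ _ ha).trans ?_)
    exact add_le_add hh (Nat.mul_le_mul_right _ hd)

end MinimalPolynomial

/-! ### Relations given by their coefficients -/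

section Relation

/-- The series `∑ c i j x ^ i f ^ j`, over `i ≤ h` and `j ≤ d`, for `f` with coefficients in an
arbitrary commutative ring: the value at `f` of the polynomial in `x` and `T` with coefficients
`c`. -/
def relationValue {R : Type*} [CommRing R] (d h : ℕ) (c : ℕ → ℕ → R) (f : R⟦X⟧) : R⟦X⟧ :=
  ∑ j ∈ Finset.range (d + 1), ∑ i ∈ Finset.range (h + 1),
    PowerSeries.C (c i j) * PowerSeries.X ^ i * f ^ j

theorem map_relationValue {R S : Type*} [CommRing R] [CommRing S] (φ : R →+* S) (d h : ℕ)
    (c : ℕ → ℕ → R) (f : R⟦X⟧) :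
    PowerSeries.map φ (relationValue d h c f) =
      relationValue d h (fun i j => φ (c i j)) (PowerSeries.map φ f) := by
  simp [relationValue, map_sum]

theorem coeff_relationValue {R : Type*} [CommRing R] (d h : ℕ) (c : ℕ → ℕ → R) (f : R⟦X⟧)
    (t : ℕ) : PowerSeries.coeff t (relationValue d h c f) =
      ∑ j ∈ Finset.range (d + 1), ∑ i ∈ Finset.range (h + 1),
        c i j * PowerSeries.coeff t (PowerSeries.X ^ i * f ^ j) := by
  simp [relationValue, map_sum, mul_assoc]

/-- The polynomial in `x` and `T` with coefficients `c i j` for `i ≤ h` and `j ≤ d`. -/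
def relationPolynomial {k : Type*} [Field k] (d h : ℕ) (c : ℕ → ℕ → k) : k[X][X] :=
  ∑ j ∈ Finset.range (d + 1), Polynomial.monomial j
    (∑ i ∈ Finset.range (h + 1), Polynomial.monomial i (c i j))

variable {k : Type*} [Field k]

theorem coeff_coeff_relationPolynomial (d h : ℕ) (c : ℕ → ℕ → k) (i j : ℕ) :
    ((relationPolynomial d h c).coeff j).coeff i = if j ≤ d ∧ i ≤ h then c i j else 0 := by
  simp only [relationPolynomial, Polynomial.finsetSum_coeff, Polynomial.coeff_monomial,
    Finset.sum_ite_eq', Finset.mem_range, Nat.lt_succ_iff]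
  by_cases hj : j ≤ d <;> by_cases hi : i ≤ h <;>
    simp [hj, hi, Polynomial.finsetSum_coeff, Polynomial.coeff_monomial]

theorem natDegree_relationPolynomial_le (d h : ℕ) (c : ℕ → ℕ → k) :
    (relationPolynomial d h c).natDegree ≤ d := by
  rw [Polynomial.natDegree_le_iff_coeff_eq_zero]
  intro N hN
  ext i
  rw [coeff_coeff_relationPolynomial, if_neg (by omega), Polynomial.coeff_zero]

theorem polynomialHeight_relationPolynomial_le (d h : ℕ) (c : ℕ → ℕ → k) :
    polynomialHeight (relationPolynomial d h c) ≤ h := by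
  rw [polynomialHeight_le_iff]
  intro j
  rw [Polynomial.natDegree_le_iff_coeff_eq_zero]
  intro N hN
  rw [coeff_coeff_relationPolynomial, if_neg (by omega)]

theorem aeval_relationPolynomial (d h : ℕ) (c : ℕ → ℕ → k) (f : k⟦X⟧) :
    aeval f (relationPolynomial d h c) = relationValue d h c f := by
  simp only [relationPolynomial, relationValue, map_sum, Polynomial.aeval_monomial]
  simp [PowerSeries.algebraMap_apply', PowerSeries.monomial_eq_C_mul_X_pow]

theorem relationPolynomial_coeff {P : k[X][X]} {d h : ℕ} (hd : P.natDegree ≤ d)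
    (hh : polynomialHeight P ≤ h) :
    relationPolynomial d h (fun i j => (P.coeff j).coeff i) = P := by
  ext j i
  rw [coeff_coeff_relationPolynomial]
  split_ifs with hij
  · rfl
  · by_cases hj : j ≤ d
    · rw [Polynomial.coeff_eq_zero_of_natDegree_lt]
      have := natDegree_coeff_le_polynomialHeight P j
      omega
    · rw [Polynomial.coeff_eq_zero_of_natDegree_lt (show P.natDegree < j by omega),
        Polynomial.coeff_zero]

end Relation

/-! ### Relations and fields of definition -/

section LinearSystem

/-- If the relations of given bidegree between `x` and a series `f` with coefficients in a subfield
`L` are all proportional, then the ratios of their coefficients lie in `L`: an `L`-linear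
retraction `K → L` maps a relation to a relation. -/
theorem div_mem_of_relationValue_eq_zero {k K : Type*} [Field k] [Field K] [Algebra k K]
    (L : IntermediateField k K) {d h : ℕ} {c : ℕ → ℕ → K} {f : K⟦X⟧}
    (hf : ∀ t, PowerSeries.coeff t f ∈ L) (hc : relationValue d h c f = 0) {i₀ j₀ : ℕ}
    (h0 : c i₀ j₀ ≠ 0)
    (huniq : ∀ c' : ℕ → ℕ → K, relationValue d h c' f = 0 →
      ∀ i j, i ≤ h → j ≤ d → c' i j * c i₀ j₀ = c' i₀ j₀ * c i j)
    {i j : ℕ} (hi : i ≤ h) (hj : j ≤ d) : c i j / c i₀ j₀ ∈ L := by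
  obtain ⟨ρ, hρ⟩ := LinearMap.exists_leftInverse_of_injective (Algebra.linearMap L K)
    (LinearMap.ker_eq_bot.2 (algebraMap L K).injective)
  have hρ1 : ρ 1 = 1 := by
    have := LinearMap.congr_fun hρ 1
    simpa using this
  have hfL : ∃ g : L⟦X⟧, PowerSeries.map (algebraMap L K) g = f :=
    ⟨PowerSeries.mk fun t => ⟨PowerSeries.coeff t f, hf t⟩, by ext t; simp⟩
  obtain ⟨g, hg⟩ := hfL
  have hpow : ∀ t i j, PowerSeries.coeff t (PowerSeries.X ^ i * f ^ j) =
      algebraMap L K (PowerSeries.coeff t (PowerSeries.X ^ i * g ^ j)) := by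
    intro t i j
    rw [← PowerSeries.coeff_map, ← hg]
    simp
  have hρc : relationValue d h (fun i j => (ρ (c i j / c i₀ j₀) : K)) f = 0 := by
    ext t
    have ht := congrArg (fun a => ρ (a / c i₀ j₀)) (congrArg (PowerSeries.coeff t) hc)
    simp only [coeff_relationValue, map_zero, zero_div, Finset.sum_div, map_sum] at ht
    rw [coeff_relationValue, map_zero, ← ZeroMemClass.coe_zero L, ← ht]
    push_cast
    refine Finset.sum_congr rfl fun j _ => Finset.sum_congr rfl fun i _ => ?_
    rw [hpow, mul_div_right_comm, mul_comm (c i j / c i₀ j₀), ← Algebra.smul_def, map_smul,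
      smul_eq_mul, mul_comm]
    rfl
  have h1 := huniq _ hρc i j hi hj
  simp only [div_self h0, hρ1, OneMemClass.coe_one, one_mul] at h1
  rw [← h1, mul_div_cancel_right₀ _ h0]
  exact SetLike.coe_mem _

theorem isAlgebraic_of_relationValue_eq_zero {L K : Type*} [Field L] [Field K] [Algebra L K]
    {d h : ℕ} {c : ℕ → ℕ → L} {f : K⟦X⟧}
    (hc : relationValue d h (fun i j => algebraMap L K (c i j)) f = 0) {i₀ j₀ : ℕ}
    (hi : i₀ ≤ h) (hj : j₀ ≤ d) (h0 : c i₀ j₀ ≠ 0) : IsAlgebraic L⟦X⟧ f := by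
  refine ⟨(relationPolynomial d h c).map Polynomial.coeToPowerSeries.ringHom, fun hP => h0 ?_, ?_⟩
  · have hinj : Function.Injective (Polynomial.coeToPowerSeries.ringHom (R := L)) :=
      Polynomial.coe_injective L
    have hP0 := (Polynomial.map_eq_zero_iff hinj).1 hP
    have hcoeff := coeff_coeff_relationPolynomial d h c i₀ j₀
    simpa [hP0, hi, hj] using hcoeff.symm
  · rw [← hc]
    simp only [relationPolynomial, relationValue, Polynomial.map_sum, Polynomial.map_monomial,
      map_sum, Polynomial.aeval_monomial]
    simp [PowerSeries.algebraMap_apply'', PowerSeries.monomial_eq_C_mul_X_pow]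

end LinearSystem

/-! ### Limits of algebraic series along an ultrafilter -/

section Ultrapower

universe u

/-- The ultrapower of a field, as a quotient of the ring of functions. -/
theorem exists_ultrapower {k S : Type u} [Field k] (U : Ultrafilter S) :
    ∃ (K : Type u) (_ : Field K) (_ : Algebra k K) (π : (S → k) →ₐ[k] K),
      Function.Surjective π ∧ ∀ a, π a = 0 ↔ ∀ᶠ s in U, a s = 0 := by
  have hmax : (RingHom.ker (Filter.Germ.coeRingHom (R := k) (U : Filter S))).IsMaximal :=
    RingHom.ker_isMaximal_of_surjective _ fun g => g.inductionOn fun a => ⟨a, rfl⟩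
  refine ⟨_, Ideal.Quotient.field (RingHom.ker (Filter.Germ.coeRingHom (R := k) (U : Filter S))),
    inferInstance, Ideal.Quotient.mkₐ k _, Ideal.Quotient.mkₐ_surjective _ _, fun a => ?_⟩
  rw [Ideal.Quotient.mkₐ_eq_mk, Ideal.Quotient.eq_zero_iff_mem, RingHom.mem_ker]
  exact Filter.Germ.coe_eq

theorem Ultrafilter.exists_eventually_eq {S T : Type*} [Finite T] (U : Ultrafilter S) (v : S → T) :
    ∃ c, ∀ᶠ s in U, v s = c := by
  have h : (⋃ c ∈ (Set.univ : Set T), {s | v s = c}) ∈ U := by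
    rw [show (⋃ c ∈ (Set.univ : Set T), {s | v s = c}) = Set.univ by ext s; simp]
    exact Filter.univ_mem
  obtain ⟨c, -, hc⟩ := (Ultrafilter.finite_biUnion_mem_iff Set.finite_univ).1 h
  exact ⟨c, hc⟩

theorem Ultrafilter.exists_eventually_eq_of_le {S : Type*} (U : Ultrafilter S) (v : S → ℕ)
    (N : ℕ) (hv : ∀ s, v s ≤ N) : ∃ c, ∀ᶠ s in U, v s = c := by
  obtain ⟨c, hc⟩ := U.exists_eventually_eq fun s => (⟨v s, Nat.lt_succ_of_le (hv s)⟩ : Fin (N + 1))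
  exact ⟨c, hc.mono fun s hs => congrArg Fin.val hs⟩

variable {k S K : Type*} [Field k] [Field K] [Algebra k K] {U : Ultrafilter S}
  {π : (S → k) →ₐ[k] K}

theorem ultrapower_eq_iff (hπ : ∀ a, π a = 0 ↔ ∀ᶠ s in U, a s = 0) {a b : S → k} :
    π a = π b ↔ ∀ᶠ s in U, a s = b s := by
  rw [← sub_eq_zero, ← map_sub, hπ]
  simp [sub_eq_zero]

theorem ultrapower_div (hπ : ∀ a, π a = 0 ↔ ∀ᶠ s in U, a s = 0) (a b : S → k) :
    π (fun s => a s / b s) = π a / π b := by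
  by_cases hb : π b = 0
  · rw [hb, div_zero, hπ]
    filter_upwards [(hπ b).1 hb] with s hs
    rw [hs, div_zero]
  · rw [eq_div_iff hb, ← map_mul, ultrapower_eq_iff hπ]
    have hb' : ∀ᶠ s in U, ¬ b s = 0 := by
      rw [Ultrafilter.eventually_not]
      exact fun h => hb ((hπ b).2 h)
    filter_upwards [hb'] with s hs
    exact div_mul_cancel₀ _ hs

/-- The series over the ultrapower whose coefficients are the classes of the coefficients of a
family of series. -/
def limitSeries (π : (S → k) →ₐ[k] K) (φ : S → k⟦X⟧) : K⟦X⟧ :=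
  PowerSeries.mk fun t => π fun s => PowerSeries.coeff t (φ s)

theorem coeff_limitSeries (φ : S → k⟦X⟧) (t : ℕ) :
    PowerSeries.coeff t (limitSeries π φ) = π fun s => PowerSeries.coeff t (φ s) :=
  PowerSeries.coeff_mk _ _

/-- The family as a single series over the ring of functions, whose images under the evaluations
are the members of the family. -/
def familySeries (φ : S → k⟦X⟧) : (S → k)⟦X⟧ :=
  PowerSeries.mk fun t s => PowerSeries.coeff t (φ s)

theorem map_familySeries (φ : S → k⟦X⟧) :
    PowerSeries.map (π : (S → k) →+* K) (familySeries φ) = limitSeries π φ := by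
  ext t; simp [familySeries, limitSeries]

theorem map_evalRingHom_familySeries (φ : S → k⟦X⟧) (s : S) :
    PowerSeries.map (Pi.evalRingHom (fun _ : S => k) s) (familySeries φ) = φ s := by
  ext t; simp [familySeries]

theorem coeff_relationValue_limitSeries (d h : ℕ) (c : ℕ → ℕ → S → k) (φ : S → k⟦X⟧) (t : ℕ) :
    PowerSeries.coeff t (relationValue d h (fun i j => π (c i j)) (limitSeries π φ)) =
      π fun s => PowerSeries.coeff t (relationValue d h (fun i j => c i j s) (φ s)) := by
  rw [← map_familySeries]
  have h1 := map_relationValue (π : (S → k) →+* K) d h c (familySeries φ)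
  simp only [RingHom.coe_coe] at h1
  rw [← h1, PowerSeries.coeff_map]
  refine congrArg π (funext fun s => ?_)
  have h2 := map_relationValue (Pi.evalRingHom (fun _ : S => k) s) d h c (familySeries φ)
  rw [map_evalRingHom_familySeries] at h2
  simp only [Pi.evalRingHom_apply] at h2
  rw [← h2, PowerSeries.coeff_map]
  rfl

/-- The coefficient at `x ^ i T ^ j` of the minimal polynomials of a family, as a function. -/
def familyCoeff (φ : S → k⟦X⟧) (i j : ℕ) (s : S) : k :=
  ((minimalPolynomial (φ s)).coeff j).coeff i

theorem exists_familyCoeff_ne_zero (hπ : ∀ a, π a = 0 ↔ ∀ᶠ s in U, a s = 0) {d h : ℕ}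
    {φ : S → k⟦X⟧} (hφ : ∀ s, φ s ∈ algebraicSeries k d h) :
    ∃ p : Fin (h + 1) × Fin (d + 1), π (familyCoeff φ p.1 p.2) ≠ 0 := by
  have hex : ∀ s, ∃ p : Fin (h + 1) × Fin (d + 1), familyCoeff φ p.1 p.2 s ≠ 0 := by
    intro s
    obtain ⟨halg, hd, hh⟩ := hφ s
    by_contra! hall
    apply minimalPolynomial_ne_zero halg
    rw [← relationPolynomial_coeff hd hh]
    ext j i
    rw [coeff_coeff_relationPolynomial]
    split_ifs with hij
    · exact hall (⟨i, by omega⟩, ⟨j, by omega⟩)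
    · simp
  choose v hv using hex
  obtain ⟨p, hp⟩ := U.exists_eventually_eq v
  refine ⟨p, fun h0 => ?_⟩
  obtain ⟨s, hs, hs'⟩ := (hp.and ((hπ _).1 h0)).exists
  exact hv s (hs ▸ hs')

theorem relationValue_familyCoeff_limitSeries {d h : ℕ} {φ : S → k⟦X⟧} 
    (hπ : ∀ a, π a = 0 ↔ ∀ᶠ s in U, a s = 0)
    (hφ : ∀ᶠ s in U, (minimalPolynomial (φ s)).natDegree ≤ d ∧
      polynomialHeight (minimalPolynomial (φ s)) ≤ h) :
    relationValue d h (fun i j => π (familyCoeff φ i j)) (limitSeries π φ) = 0 := by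
  ext t
  rw [coeff_relationValue_limitSeries, map_zero, hπ]
  filter_upwards [hφ] with s hs
  rw [← aeval_relationPolynomial]
  have := relationPolynomial_coeff hs.1 hs.2
  rw [show relationPolynomial d h (fun i j => familyCoeff φ i j s) = minimalPolynomial (φ s) from
    this, aeval_minimalPolynomial, map_zero]

/-- The coefficients of the limit of algebraic series are algebraic over the field generated by the
ratios of the coefficients of their minimal polynomials. -/
theorem coeff_limitSeries_mem (hπ : ∀ a, π a = 0 ↔ ∀ᶠ s in U, a s = 0) {d h : ℕ}
    {φ : S → k⟦X⟧} (hφ : ∀ s, φ s ∈ algebraicSeries k d h) (L : IntermediateField k K)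
    (hL : ∀ a : K, IsAlgebraic L a → a ∈ L) (p : Fin (h + 1) × Fin (d + 1))
    (hp : π (familyCoeff φ p.1 p.2) ≠ 0)
    (hpL : ∀ q : Fin (h + 1) × Fin (d + 1),
      π (familyCoeff φ q.1 q.2) / π (familyCoeff φ p.1 p.2) ∈ L) (t : ℕ) :
    PowerSeries.coeff t (limitSeries π φ) ∈ L := by
  set b := π (familyCoeff φ p.1 p.2)
  let c : ℕ → ℕ → L := fun i j => if hij : i ≤ h ∧ j ≤ d then
    ⟨π (familyCoeff φ i j) / b, hpL (⟨i, by omega⟩, ⟨j, by omega⟩)⟩ else 0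
  have hrel := relationValue_familyCoeff_limitSeries hπ
    (Filter.Eventually.of_forall fun s => ⟨(hφ s).2.1, (hφ s).2.2⟩)
  have hc : relationValue d h (fun i j => algebraMap L K (c i j)) (limitSeries π φ) = 0 := by
    rw [← mul_zero (PowerSeries.C b⁻¹), ← hrel]
    simp only [relationValue, Finset.mul_sum]
    refine Finset.sum_congr rfl fun j hj => Finset.sum_congr rfl fun i hi => ?_
    rw [Finset.mem_range, Nat.lt_succ_iff] at hi hj
    have hcij : algebraMap L K (c i j) = b⁻¹ * π (familyCoeff φ i j) := by
      simp only [c, dif_pos (And.intro hi hj)]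
      exact div_eq_inv_mul _ _
    rw [hcij, map_mul]
    ring
  have hp1 : (p.1 : ℕ) ≤ h ∧ (p.2 : ℕ) ≤ d := by omega
  have hcp : c p.1 p.2 ≠ 0 := by
    simp only [c, dif_pos hp1, ne_eq, ← ZeroMemClass.coe_eq_zero]
    exact div_ne_zero hp hp
  obtain ⟨a, ha⟩ := coeff_mem_range_of_isAlgebraic (L := L) (K := K)
    (fun x hx => ⟨⟨x, hL x hx⟩, rfl⟩) t
    (isAlgebraic_of_relationValue_eq_zero hc hp1.1 hp1.2 hcp)
  rw [← ha]
  exact a.2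

/-- The ratios of the coefficients of the minimal polynomials of a family of algebraic series lie,
in the limit, in every field that contains the coefficients of the limit series. -/
theorem div_familyCoeff_mem (hsurj : Function.Surjective π)
    (hπ : ∀ a, π a = 0 ↔ ∀ᶠ s in U, a s = 0) {d h : ℕ}
    {φ : S → k⟦X⟧} (hφ : ∀ s, φ s ∈ algebraicSeries k d h) (L : IntermediateField k K)
    (hcoeff : ∀ t, PowerSeries.coeff t (limitSeries π φ) ∈ L) (i j i' j' : ℕ) :
    π (familyCoeff φ i j) / π (familyCoeff φ i' j') ∈ L := by
  -- The bidegree is constant on a member of the ultrafilter.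
  obtain ⟨d', hd'⟩ := U.exists_eventually_eq_of_le
    (fun s => (minimalPolynomial (φ s)).natDegree) d fun s => (hφ s).2.1
  obtain ⟨h', hh'⟩ := U.exists_eventually_eq_of_le
    (fun s => polynomialHeight (minimalPolynomial (φ s))) h fun s => (hφ s).2.2
  obtain ⟨p, hp⟩ := exists_familyCoeff_ne_zero hπ hφ
  have hrel := relationValue_familyCoeff_limitSeries hπ (d := d') (h := h') (φ := φ) (by
    filter_upwards [hd', hh'] with s h1 h2
    exact ⟨h1.le, h2.le⟩)
  have hout : ∀ i j, ¬ (i ≤ h' ∧ j ≤ d') → π (familyCoeff φ i j) = 0 := by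
    intro i j hij
    rw [hπ]
    filter_upwards [hd', hh'] with s h1 h2
    rw [familyCoeff]
    by_cases hj : j ≤ d'
    · apply Polynomial.coeff_eq_zero_of_natDegree_lt
      have := natDegree_coeff_le_polynomialHeight (minimalPolynomial (φ s)) j
      omega
    · rw [Polynomial.coeff_eq_zero_of_natDegree_lt
        (show (minimalPolynomial (φ s)).natDegree < j by omega), Polynomial.coeff_zero]
  have hpd : (p.1 : ℕ) ≤ h' ∧ (p.2 : ℕ) ≤ d' := by
    by_contra hnot
    exact hp (hout _ _ hnot)
  have hmain : ∀ i j, π (familyCoeff φ i j) / π (familyCoeff φ p.1 p.2) ∈ L := by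
    intro i j
    by_cases hij : i ≤ h' ∧ j ≤ d'
    · refine div_mem_of_relationValue_eq_zero L hcoeff hrel hp ?_ hij.1 hij.2
      intro c hc i j hi hj
      -- A relation over `K` is the limit of polynomials over `k` whose values at the series of the
      -- family vanish to any given order, hence vanish because of the bound on the order.
      choose b hb using fun i j => hsurj (c i j)
      have hc' : ∀ t, ∀ᶠ s in U, PowerSeries.coeff t
          (aeval (φ s) (relationPolynomial d' h' fun i j => b i j s)) = 0 := by
        intro t
        have h1 := congrArg (PowerSeries.coeff t) hc
        rw [show c = fun i j => π (b i j) from funext₂ fun i j => (hb i j).symm,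
          coeff_relationValue_limitSeries, map_zero, hπ] at h1
        filter_upwards [h1] with s hs
        rw [aeval_relationPolynomial, hs]
      have hall : ∀ᶠ s in U, ∀ t ∈ Finset.range ((d' + d') * h' + 1), PowerSeries.coeff t
          (aeval (φ s) (relationPolynomial d' h' fun i j => b i j s)) = 0 :=
        (Filter.eventually_all_finset _).2 fun t _ => hc' t
      rw [← hb, ← hb, ← map_mul, ← map_mul, ultrapower_eq_iff hπ]
      filter_upwards [hall, hd', hh'] with s hs h1 h2
      have hdeg := natDegree_relationPolynomial_le d' h' fun i j => b i j s
      have hht := polynomialHeight_relationPolynomial_le d' h' fun i j => b i j s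
      have hzero : aeval (φ s) (relationPolynomial d' h' fun i j => b i j s) = 0 := by
        refine aeval_eq_zero_of_coeff_eq_zero (hφ s).1 fun t ht => hs t ?_
        rw [Finset.mem_range, Nat.lt_succ_iff]
        refine ht.trans (Nat.mul_le_mul (add_le_add h1.le hdeg) (max_le h2.le hht))
      obtain ⟨r, hr⟩ := eq_C_C_mul_minimalPolynomial (hφ s).1 hzero (hdeg.trans h1.ge)
        (hht.trans h2.ge)
      have hb' : ∀ i j, i ≤ h' → j ≤ d' → b i j s = r * familyCoeff φ i j s := by
        intro i j hi hj
        have := coeff_coeff_relationPolynomial d' h' (fun i j => b i j s) i j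
        rw [hr, if_pos ⟨hj, hi⟩, Polynomial.coeff_C_mul, Polynomial.coeff_C_mul] at this
        exact this.symm
      rw [Pi.mul_apply, Pi.mul_apply, hb' i j hi hj, hb' p.1 p.2 hpd.1 hpd.2]
      ring
    · rw [hout i j hij, zero_div]
      exact zero_mem L
  have h3 := div_mem (hmain i j) (hmain i' j')
  rwa [div_div_div_cancel_right₀ hp] at h3

/-- The coordinates of the members of a family of algebraic series lie, in the limit, in every
field that contains the coefficients of the limit series. -/
theorem seriesCoord_mem (hsurj : Function.Surjective π)
    (hπ : ∀ a, π a = 0 ↔ ∀ᶠ s in U, a s = 0) {d h : ℕ}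
    {φ : S → k⟦X⟧} (hφ : ∀ s, φ s ∈ algebraicSeries k d h) (L : IntermediateField k K)
    (hcoeff : ∀ t, PowerSeries.coeff t (limitSeries π φ) ∈ L) (c : CoordIndex d h) :
    π (fun s => seriesCoord d h (φ s) c) ∈ L := by
  simp only [coeff_limitSeries] at hcoeff
  obtain ⟨e, he⟩ := U.exists_eventually_eq_of_le (fun s => derivativeOrder (φ s)) (2 * d * h)
    fun s => derivativeOrder_le (hφ s)
  rcases c with c | t | p
  · simpa [seriesCoord] using hcoeff 0
  · rcases lt_trichotomy (t : ℕ) e with ht | ht | ht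
    · have : π (fun s => seriesCoord d h (φ s) (Sum.inr (Sum.inl t))) =
          π fun s => PowerSeries.coeff (t + 1) (φ s) := by
        rw [ultrapower_eq_iff hπ]
        filter_upwards [he] with s hs
        simp [seriesCoord, hs, ht]
      rw [this]
      exact hcoeff _
    · have : π (fun s => seriesCoord d h (φ s) (Sum.inr (Sum.inl t))) = π 1 := by
        rw [ultrapower_eq_iff hπ]
        filter_upwards [he] with s hs
        simp [seriesCoord, hs, ht]
      rw [this, map_one]
      exact one_mem L
    · have : π (fun s => seriesCoord d h (φ s) (Sum.inr (Sum.inl t))) = 0 := by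
        rw [hπ]
        filter_upwards [he] with s hs
        simp [seriesCoord, hs, ht.not_gt, ht.ne']
      rw [this]
      exact zero_mem L
  · set γ : S → k⟦X⟧ := fun s => seriesTail (derivativeOrder (φ s)) (φ s) with hγdef
    have hγ : ∀ s, γ s ∈ algebraicSeries k d (h + d * (2 * d * h)) := by
      intro s
      obtain ⟨h1, h2, h3⟩ := seriesTail_mem_algebraicSeries (hφ s) (derivativeOrder (φ s))
      exact ⟨h1, h2, h3.trans
        (Nat.add_le_add_left (Nat.mul_le_mul_left _ (derivativeOrder_le (hφ s))) _)⟩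
    have hγcoeff : ∀ t, PowerSeries.coeff t (limitSeries π γ) ∈ L := by
      intro t
      rw [coeff_limitSeries]
      have : π (fun s => PowerSeries.coeff t (γ s)) =
          if t = 0 then 0 else π fun s => PowerSeries.coeff (t + e) (φ s) := by
        split_ifs with ht
        · rw [hπ]
          exact Filter.Eventually.of_forall fun s => by simp [hγdef, seriesTail, ht]
        · rw [ultrapower_eq_iff hπ]
          filter_upwards [he] with s hs
          simp [hγdef, seriesTail, ht, hs]
      rw [this]
      split_ifs
      · exact zero_mem L
      · exact hcoeff _
    have h1 := div_familyCoeff_mem hsurj hπ hγ L hγcoeff p.1.1 p.1.2 0 1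
    rw [← ultrapower_div hπ] at h1
    exact h1

end Ultrapower

/-! ### Transcendence degree -/

section Transcendence

/-- The relative algebraic closure of a field generated by finitely many elements, with the bound on
its transcendence degree. -/
theorem exists_algebraicallyClosedIn_le_card {k K ι : Type*} [Field k] [Field K] [Algebra k K]
    [Fintype ι] (c : ι → K) :
    ∃ L : IntermediateField k K, (∀ i, c i ∈ L) ∧ (∀ a : K, IsAlgebraic L a → a ∈ L) ∧
      ∀ (s : ℕ) (y : Fin s → K), AlgebraicIndependent k y → (∀ i, y i ∈ L) →
        s ≤ Fintype.card ι := by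
  set L₀ := IntermediateField.adjoin k (Set.range c)
  refine ⟨(algebraicClosure L₀ K).restrictScalars k, fun i => ?_, fun a ha => ?_,
    fun s y hy hyL => ?_⟩
  · rw [IntermediateField.mem_restrictScalars]
    exact (algebraicClosure L₀ K).algebraMap_mem
      ⟨c i, IntermediateField.subset_adjoin k _ ⟨i, rfl⟩⟩
  · rw [IntermediateField.mem_restrictScalars, mem_algebraicClosure_iff]
    have ha' : IsAlgebraic (algebraicClosure L₀ K) a := ha
    exact ha'.restrictScalars L₀
  · have hsub : Set.range y ⊆ (AlgebraicIndependent.matroid k K).closure (Set.range c) := by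
      rintro _ ⟨i, rfl⟩
      rw [AlgebraicIndependent.matroid_closure_eq]
      have hi := hyL i
      rw [IntermediateField.mem_restrictScalars, mem_algebraicClosure_iff,
        IntermediateField.isAlgebraic_adjoin_iff] at hi
      exact hi
    have hind : (AlgebraicIndependent.matroid k K).Indep (Set.range y) :=
      AlgebraicIndependent.matroid_indep_iff.2 hy.to_subtype_range
    have hle := hind.encard_le_eRk_of_subset hsub
    rw [Matroid.eRk_closure_eq] at hle
    have hle' := hle.trans (Matroid.eRk_le_encard _ _)
    have h1 : (Set.range y).encard = s := by
      rw [← Set.image_univ, hy.injective.encard_image]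
      simp
    have h2 : (Set.range c).encard ≤ Fintype.card ι := by
      rw [← Set.image_univ]
      exact (Set.encard_image_le _ _).trans (by simp)
    rw [h1] at hle'
    exact_mod_cast hle'.trans h2

/-- A maximal algebraically independent subfamily of a finite family. -/
theorem exists_algebraicIndepOn_isAlgebraic {R A ι : Type*} [CommRing R] [CommRing A]
    [Algebra R A] [Finite ι] (hinj : Function.Injective (algebraMap R A)) (f : ι → A) :
    ∃ B : Set ι, AlgebraicIndepOn R f B ∧
      ∀ j ∉ B, IsAlgebraic (Algebra.adjoin R (f '' B)) (f j) := by
  have hne : {B : Set ι | AlgebraicIndepOn R f B}.Nonempty :=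
    ⟨∅, algebraicIndependent_empty_type_iff.2 hinj⟩
  obtain ⟨B, hB, hmax⟩ := (Set.toFinite {B : Set ι | AlgebraicIndepOn R f B}).exists_maximal hne
  refine ⟨B, hB, fun j hj => ?_⟩
  by_contra h
  have hins : AlgebraicIndepOn R f (insert j B) :=
    (AlgebraicIndepOn.insert_iff hj).2 ⟨hB, h⟩
  exact hj (hmax hins (Set.subset_insert _ _) (Set.mem_insert _ _))

end Transcendence

/-! ### Dimension of a Zariski closure -/

section Dimension

universe u

/-- To bound the dimension of the Zariski closure of a parametrized set, it is enough to bound the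
transcendence degree of the limits of the coordinates along ultrafilters. -/
theorem algebraicSetDim_zariskiClosure_range_le {k S : Type u} {σ : Type*} [Field k] [Finite σ]
    (p : S → σ → k) (r : ℕ)
    (H : ∀ (U : Ultrafilter S) (K : Type u) [Field K] [Algebra k K] (π : (S → k) →ₐ[k] K),
      Function.Surjective π → (∀ a, π a = 0 ↔ ∀ᶠ s in U, a s = 0) →
      ∃ L : IntermediateField k K, (∀ c, π (fun s => p s c) ∈ L) ∧
        ∀ (t : ℕ) (y : Fin t → K), AlgebraicIndependent k y → (∀ i, y i ∈ L) → t ≤ r) :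
    algebraicSetDim (zariskiClosure (Set.range p)) ≤ (r : WithBot ℕ∞) := by
  have hclosure : MvPolynomial.vanishingIdeal k (zariskiClosure (Set.range p)) =
      MvPolynomial.vanishingIdeal k (Set.range p) :=
    le_antisymm (MvPolynomial.vanishingIdeal_anti_mono
      (MvPolynomial.zeroLocus_vanishingIdeal_le _))
      (MvPolynomial.le_vanishingIdeal_zeroLocus _)
  rw [algebraicSetDim, hclosure]
  set J := MvPolynomial.vanishingIdeal k (Set.range p)
  cases subsingleton_or_nontrivial (MvPolynomial σ k ⧸ J) with
  | inl hsub => rw [ringKrullDim_eq_bot_of_subsingleton]; exact bot_le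
  | inr hnt =>
  obtain ⟨t, y, hy, hdim⟩ :=
    exists_algebraicIndependent_ringKrullDim_eq k (MvPolynomial σ k ⧸ J)
  rw [hdim]
  choose G hG using fun i => Ideal.Quotient.mkₐ_surjective k J (y i)
  -- The functions on `S` defined by `G` are algebraically independent.
  set Y : Fin t → S → k := fun i s => MvPolynomial.aeval (p s) (G i)
  have hcomp : ∀ (q : MvPolynomial (Fin t) k) (s : S),
      MvPolynomial.aeval (p s) (MvPolynomial.aeval G q) = (MvPolynomial.aeval Y q : S → k) s := by
    intro q s
    have h1 := MvPolynomial.comp_aeval_apply (MvPolynomial.aeval (p s)) (f := G) q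
    have h2 := MvPolynomial.comp_aeval_apply (Pi.evalAlgHom k (fun _ : S => k) s) (f := Y) q
    rw [h1]
    exact h2.symm
  have hne : ∀ q : MvPolynomial (Fin t) k, q ≠ 0 →
      ∃ s, (MvPolynomial.aeval Y q : S → k) s ≠ 0 := by
    intro q hq
    by_contra! hall
    apply hq
    rw [algebraicIndependent_iff] at hy
    apply hy
    have h1 := MvPolynomial.comp_aeval_apply (Ideal.Quotient.mkₐ k J) (f := G) q
    simp only [hG] at h1
    rw [← h1, Ideal.Quotient.mkₐ_eq_mk, Ideal.Quotient.eq_zero_iff_mem]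
    rintro _ ⟨s, rfl⟩
    rw [hcomp, hall]
  -- The sets on which the nonzero polynomials in `Y` do not vanish generate a proper filter.
  set Z : {q : MvPolynomial (Fin t) k // q ≠ 0} → Filter S := fun q =>
    Filter.principal {s | (MvPolynomial.aeval Y q.1 : S → k) s ≠ 0}
  have hdir : Directed (· ≥ ·) Z := by
    intro q q'
    refine ⟨⟨q.1 * q'.1, mul_ne_zero q.2 q'.2⟩, ?_, ?_⟩ <;>
    · refine Filter.principal_mono.2 fun s hs => ?_
      simp only [map_mul, Set.mem_ofPred_eq, Pi.mul_apply] at hs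
      first
      | exact left_ne_zero_of_mul hs
      | exact right_ne_zero_of_mul hs
  have : Nonempty {q : MvPolynomial (Fin t) k // q ≠ 0} := ⟨⟨1, one_ne_zero⟩⟩
  have hbot : (⨅ q, Z q).NeBot :=
    Filter.iInf_neBot_of_directed' hdir fun q => Filter.principal_neBot_iff.2 (hne q.1 q.2)
  obtain ⟨U, hU⟩ : ∃ U : Ultrafilter S, ∀ q : MvPolynomial (Fin t) k, q ≠ 0 →
      ∀ᶠ s in U, (MvPolynomial.aeval Y q : S → k) s ≠ 0 := by
    obtain ⟨U, hU⟩ := Ultrafilter.exists_le (⨅ q, Z q)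
    exact ⟨U, fun q hq => Filter.le_principal_iff.1 (hU.trans (iInf_le Z ⟨q, hq⟩))⟩
  obtain ⟨K, _, _, π, hsurj, hπ⟩ := exists_ultrapower (k := k) U
  obtain ⟨L, hL, hLt⟩ := H _ K π hsurj hπ
  have hlim : AlgebraicIndependent k fun i => π (Y i) := by
    rw [algebraicIndependent_iff]
    intro q hq
    by_contra hq0
    have h1 := MvPolynomial.comp_aeval_apply π (f := Y) q
    rw [← h1, hπ] at hq
    obtain ⟨s, hs, hs'⟩ := (hq.and (hU q hq0)).exists
    exact hs' hs
  have hmem : ∀ i, π (Y i) ∈ L := by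
    intro i
    have h1 : Y i = MvPolynomial.aeval (fun c s => p s c) (G i) := by
      funext s
      have := MvPolynomial.comp_aeval_apply (Pi.evalAlgHom k (fun _ : S => k) s)
        (f := fun c s => p s c) (G i)
      exact this.symm
    rw [h1, MvPolynomial.comp_aeval_apply]
    have h2 : MvPolynomial.aeval (fun c => π fun s => p s c) (G i) ∈
        Algebra.adjoin k (Set.range fun c => π fun s => p s c) := by
      rw [Algebra.adjoin_range_eq_range_aeval]
      exact ⟨_, rfl⟩
    exact (Algebra.adjoin_le (S := L.toSubalgebra) (by rintro _ ⟨c, rfl⟩; exact hL c)) h2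
  exact_mod_cast hLt t _ hlim hmem

/-- Series that lie on a variety of dimension `m` have limits of transcendence degree at most `m`
over `k⟦X⟧`: a polynomial over `k⟦X⟧` that vanishes on the variety vanishes at the limits. -/
theorem card_le_of_algebraicIndepOn_limitSeries {k S K : Type*} [Field k] [Field K] [Algebra k K]
    (π : (S → k) →ₐ[k] K) {n m : ℕ} (I : Ideal (MvPolynomial (Fin n) k⸨X⸩))
    (hI : ringKrullDim (MvPolynomial (Fin n) k⸨X⸩ ⧸ I) = (m : WithBot ℕ∞))
    (φ : Fin n → S → k⟦X⟧)
    (hφ : ∀ s, (fun i => algebraMap k⟦X⟧ k⸨X⸩ (φ i s)) ∈ MvPolynomial.zeroLocus k⸨X⸩ I)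
    (B : Set (Fin n)) [Fintype B]
    (hB : AlgebraicIndepOn k⟦X⟧ (fun i => limitSeries π (φ i)) B) :
    Fintype.card B ≤ m := by
  have hx : AlgebraicIndependent k⟦X⟧
      (fun i : B => Ideal.Quotient.mkₐ k⟦X⟧ I (MvPolynomial.X (i : Fin n))) := by
    rw [AlgebraicIndepOn, algebraicIndependent_iff] at hB
    rw [algebraicIndependent_iff]
    intro q hq
    rw [← MvPolynomial.comp_aeval_apply, Ideal.Quotient.mkₐ_eq_mk,
      Ideal.Quotient.eq_zero_iff_mem] at hq
    have heval : ∀ s, MvPolynomial.eval (fun i : B => φ i s) q = 0 := by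
      intro s
      have h1 := hφ s _ hq
      have h2 := MvPolynomial.comp_aeval_apply ((MvPolynomial.aeval
        (fun i => algebraMap k⟦X⟧ k⸨X⸩ (φ i s)) : MvPolynomial (Fin n) k⸨X⸩ →ₐ[k⸨X⸩]
          k⸨X⸩).restrictScalars k⟦X⟧) (f := fun i : B => MvPolynomial.X (i : Fin n)) q
      rw [AlgHom.restrictScalars_apply, h1] at h2
      simp only [AlgHom.restrictScalars_apply, MvPolynomial.aeval_X] at h2
      apply IsFractionRing.injective k⟦X⟧ k⸨X⸩
      rw [map_zero, h2, MvPolynomial.eval, MvPolynomial.coe_eval₂Hom,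
        MvPolynomial.eval₂_comp_left, MvPolynomial.aeval_def]
      rfl
    have hfam : MvPolynomial.aeval (fun i : B => familySeries (φ i)) q = 0 := by
      ext t s
      have h1 := MvPolynomial.map_aeval (fun i : B => familySeries (φ i))
        (PowerSeries.map (Pi.evalRingHom (fun _ : S => k) s)) q
      simp only [map_evalRingHom_familySeries] at h1
      have h2 : (PowerSeries.map (Pi.evalRingHom (fun _ : S => k) s)).comp
          (algebraMap k⟦X⟧ (S → k)⟦X⟧) = RingHom.id _ := by
        ext f n
        simp [PowerSeries.algebraMap_apply'']
      rw [h2] at h1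
      have h3 := congrArg (PowerSeries.coeff t) (h1.trans (heval s))
      rw [PowerSeries.coeff_map] at h3
      exact h3
    apply hB
    have h1 := MvPolynomial.map_aeval (fun i : B => familySeries (φ i))
        (PowerSeries.map (π : (S → k) →+* K)) q
    have h2 : (PowerSeries.map (π : (S → k) →+* K)).comp
          (algebraMap k⟦X⟧ (S → k)⟦X⟧) = algebraMap k⟦X⟧ K⟦X⟧ := by
      ext f n
      simp [PowerSeries.algebraMap_apply'']
    rw [hfam, map_zero, h2] at h1
    simp only [map_familySeries] at h1
    exact h1.symm
  have halg : Algebra.IsAlgebraic k⟦X⟧ k⸨X⸩ :=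
    IsLocalization.isAlgebraic k⸨X⸩ (nonZeroDivisors k⟦X⟧)
  have hx' := hx.extendScalars k⸨X⸩
  have h := card_le_ringKrullDim hx'
  rw [hI] at h
  exact_mod_cast h

end Dimension

/-- Algebraicity over a subring generated by series with coefficients in `L` gives algebraicity over
`L⟦X⟧`. -/
theorem isAlgebraic_powerSeries_of_adjoin {k K ι : Type*} [Field k] [Field K] [Algebra k K]
    (L : IntermediateField k K) (f : ι → K⟦X⟧) (B : Set ι)
    (hB : ∀ i ∈ B, ∀ t, PowerSeries.coeff t (f i) ∈ L) {g : K⟦X⟧}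
    (hg : IsAlgebraic (Algebra.adjoin k⟦X⟧ (f '' B)) g) : IsAlgebraic L⟦X⟧ g := by
  let A : Subalgebra k⟦X⟧ K⟦X⟧ :=
    { (algebraMap L⟦X⟧ K⟦X⟧).range with
      algebraMap_mem' := fun a => ⟨PowerSeries.map (algebraMap k L) a, by
        ext t
        simp [PowerSeries.algebraMap_apply'', ← IsScalarTower.algebraMap_apply]⟩ }
  have hle : Algebra.adjoin k⟦X⟧ (f '' B) ≤ A := by
    refine Algebra.adjoin_le ?_
    rintro _ ⟨i, hi, rfl⟩
    exact ⟨PowerSeries.mk fun t => ⟨PowerSeries.coeff t (f i), hB i hi t⟩, by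
      ext t
      simp [PowerSeries.algebraMap_apply'']⟩
  have h1 : IsAlgebraic A g := hg.tower_top_of_subalgebra_le hle
  exact IsAlgebraic.of_ringHom_of_comp_eq (S := A) (f := (algebraMap L⟦X⟧ K⟦X⟧).rangeRestrict)
    (g := RingHom.id K⟦X⟧) h1 (RingHom.rangeRestrict_surjective _) Function.injective_id rfl

end

theorem theorem3 {k : Type*} [Field k] [IsAlgClosed k] (n m d h : ℕ)
    (I : Ideal (MvPolynomial (Fin n) k⸨X⸩))
    (hI : ringKrullDim (MvPolynomial (Fin n) k⸨X⸩ ⧸ I) = (m : WithBot ℕ∞)) :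
    boundedDim d h (MvPolynomial.zeroLocus k⸨X⸩ I) ≤
      ((m * (d * h + d + h) : ℕ) : WithBot ℕ∞) := by
  classical
  rw [boundedDim, Set.image_eq_range]
  apply algebraicSetDim_zariskiClosure_range_le
  intro U K _ _ π hsurj hπ
  set φ : Fin n → boundedPoints d h (MvPolynomial.zeroLocus k⸨X⸩ I) → k⟦X⟧ :=
    fun i s => s.1 i
  have hφ : ∀ i s, φ i s ∈ algebraicSeries k d h := fun i s => s.2.1 i
  have hinj : Function.Injective (algebraMap k⟦X⟧ K⟦X⟧) :=
    PowerSeries.map_injective _ (algebraMap k K).injective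
  obtain ⟨B, hB, hBalg⟩ := exists_algebraicIndepOn_isAlgebraic hinj
    fun i => limitSeries π (φ i)
  have hcard := card_le_of_algebraicIndepOn_limitSeries π I hI φ (fun s => s.2.2) B hB
  choose p hp using fun i => exists_familyCoeff_ne_zero hπ (hφ i)
  -- One coefficient of each minimal polynomial is normalized to `1` and does not count.
  let c : (Σ i : B, {q : Fin (h + 1) × Fin (d + 1) // q ≠ p i}) → K := fun x =>
    π (familyCoeff (φ x.1) x.2.1.1 x.2.1.2) / π (familyCoeff (φ x.1) (p x.1).1 (p x.1).2)
  have hc : Fintype.card (Σ i : B, {q : Fin (h + 1) × Fin (d + 1) // q ≠ p i}) ≤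
      m * (d * h + d + h) := by
    have h1 : ∀ i : B, Fintype.card {q : Fin (h + 1) × Fin (d + 1) // q ≠ p i} =
        d * h + d + h := by
      intro i
      rw [Fintype.card_subtype_compl, Fintype.card_subtype_eq, Fintype.card_prod,
        Fintype.card_fin, Fintype.card_fin]
      rw [show (h + 1) * (d + 1) = d * h + d + h + 1 by ring, Nat.add_sub_cancel]
    rw [Fintype.card_sigma, Finset.sum_congr rfl fun i _ => h1 i]
    simpa using Nat.mul_le_mul_right _ hcard
  obtain ⟨L, hcL, hL, hLcard⟩ := exists_algebraicallyClosedIn_le_card (k := k) c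
  have hBcoeff : ∀ i ∈ B, ∀ t, PowerSeries.coeff t (limitSeries π (φ i)) ∈ L := by
    intro i hi
    refine coeff_limitSeries_mem hπ (hφ i) L hL (p i) (hp i) fun q => ?_
    by_cases hq : q = p i
    · rw [hq, div_self (hp i)]
      exact one_mem L
    · exact hcL ⟨⟨i, hi⟩, ⟨q, hq⟩⟩
  have hcoeff : ∀ i t, PowerSeries.coeff t (limitSeries π (φ i)) ∈ L := by
    intro i t
    by_cases hi : i ∈ B
    · exact hBcoeff i hi t
    · obtain ⟨a, ha⟩ := coeff_mem_range_of_isAlgebraic (L := L) (K := K)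
        (fun x hx => ⟨⟨x, hL x hx⟩, rfl⟩) t
        (isAlgebraic_powerSeries_of_adjoin L _ B hBcoeff (hBalg i hi))
      rw [← ha]
      exact a.2
  refine ⟨L, fun x => seriesCoord_mem hsurj hπ (hφ x.1) L (hcoeff x.1) x.2, fun t y hy hyL => ?_⟩
  exact (hLcard t y hy hyL).trans hc
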